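/- Let $n\ge 1$ and let $V\in C^2(\mathbb{R}^n)$ be real-valued. Let $u\in C^2(\mathbb{R}^n)$ satisfy $u>0$ and $$\Delta u+2u\log u+V(x)u=0\quad\text{on }\mathbb{R}^n .$$ (1) If $V$ and $|\nabla V|$ are bounded on $\mathbb{R}^n$, then $u$ is bounded, and for every $x\in\mathbb{R}^n$ $$u(x)\le \exp\Big(\tfrac13\Big\{16n+8\sup_{\mathbb{R}^n}|V|+\tfrac83\sup_{\mathbb{R}^n}|\nabla V|^2-8V(x)\Big\}\Big).$$ In particular, if $V$ is a constant $c\ge 0$, the exponent on the right-hand side equals $16n/3$, independently of $c$. (2) If $V$, $\Delta V$ and $|\nabla V|$ are bounded on $\mathbb{R}^n$, then $u$ is bounded, and for every $x\in\mathbb{R}^n$ $$u(x)\le \exp\Big(2n+\sup_{\mathbb{R}^n}|\Delta V|+\tfrac12\sup_{\mathbb{R}^n}|\nabla V|+2\sup_{\mathbb{R}^n}|V|\Big).$$ If $V$ is a constant $c\le 0$, the exponent in (2) is strictly smaller than the exponent in (1). -/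

import Mathlib

open Real

noncomputable section

/-- `u` is a positive classical (`C²`) solution of `Δu + 2 u log u + V u = 0` on all of `ℝⁿ`. -/
structure IsPositiveSolution {n : ℕ} (V u : EuclideanSpace ℝ (Fin n) → ℝ) : Prop where
  contDiff : ContDiff ℝ 2 u
  pos : ∀ x, 0 < u x
  equation : ∀ x, Laplacian.laplacian u x + 2 * u x * Real.log (u x) + V x * u x = 0

/-- A real function on `ℝⁿ` is bounded. -/
def IsBoundedFun {n : ℕ} (g : EuclideanSpace ℝ (Fin n) → ℝ) : Prop :=
  ∃ C : ℝ, ∀ x, |g x| ≤ C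

/-- The exponent of the first bound (it depends on the point `x` through `V x`):
`(16 n + 8 sup |V| + (8/3) sup |∇V|² - 8 V(x)) / 3`. -/
def gradientExponent {n : ℕ} (V : EuclideanSpace ℝ (Fin n) → ℝ)
    (x : EuclideanSpace ℝ (Fin n)) : ℝ :=
  (1 / 3 : ℝ) * (16 * (n : ℝ) + 8 * (⨆ y, |V y|) + (8 / 3 : ℝ) * (⨆ y, ‖gradient V y‖ ^ 2)
    - 8 * V x)

/-- The exponent of the second bound:
`2 n + sup |ΔV| + (1/2) sup |∇V| + 2 sup |V|`. -/
def laplacianExponent {n : ℕ} (V : EuclideanSpace ℝ (Fin n) → ℝ) : ℝ :=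
  2 * (n : ℝ) + (⨆ y, |Laplacian.laplacian V y|) + (1 / 2 : ℝ) * (⨆ y, ‖gradient V y‖)
    + 2 * (⨆ y, |V y|)

end

/-! The logarithm `w = log u` solves Δw + |∇w|² + 2w + V = 0, and w is bounded above by the
Bernstein method applied to F = |∇w|² + 4w + W, where W is an auxiliary C² function with W ≤ 2U and
U is the potential of w (V up to an additive constant).

Along the drift Laplacian Δ + 2∇w·∇, Bochner's formula and the equation give 2|D²w|² − 8w − 4U + ΔW
+ 2∇w·∇(W − U) for F (`driftLaplacian_gradSq_add`); the coefficient 4 cancels the |∇w|² terms. Since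
−Δw = F/2 + |∇w|²/2 + (2U − W)/2, the inequality |D²w|² ≥ (Δw)²/n yields, where F ≥ 2n, the lower
bound F²/(2n) + F|∇w|²/n − 2F − const. The quadratic term confines F from above, with no growth
assumption on u, through a cutoff on a ball (`le_of_driftLaplacian_ge`). As F ≥ 4w wherever W ≥ 0,
this bounds w at the centre (`le_of_logPotential_bounds`).

Bochner's formula needs w in C³, while u is only C². The equation makes Δw a C¹ function, so
mollifications of w have potentials converging to U in C¹ on balls, and the estimate passes to the
limit (`exists_contDiff_approx`). Keeping W apart from U means that no second derivative of U has to
converge.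

Adding c/2 to w replaces V by V − c. The first estimate takes W = 0, so only ∇V enters, and a ball
on which V ≥ c. The second takes W = V + sup|V| and c = −sup|V|, so ∇(W − V) = 0 and only ΔV enters.
-/

/-- The `i`-th partial derivative of a real function on `ℝⁿ`. -/
noncomputable def pd {n : ℕ} (i : Fin n) (f : EuclideanSpace ℝ (Fin n) → ℝ)
    (x : EuclideanSpace ℝ (Fin n)) : ℝ :=
  fderiv ℝ f x (EuclideanSpace.single i 1)

/-! ### Calculus of coordinate derivatives and necessary conditions at a local maximum. -/

section PartialDerivatives

variable {n : ℕ} {f g : EuclideanSpace ℝ (Fin n) → ℝ} {x : EuclideanSpace ℝ (Fin n)}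

theorem ContDiff.pd {m k : ℕ∞} (hf : ContDiff ℝ m f) (hk : k + 1 ≤ m) (i : Fin n) :
    ContDiff ℝ k (pd i f) :=
  (hf.fderiv_right (by exact_mod_cast hk)).clm_apply contDiff_const

theorem pd_add (hf : DifferentiableAt ℝ f x) (hg : DifferentiableAt ℝ g x) (i : Fin n) :
    pd i (fun y => f y + g y) x = pd i f x + pd i g x := by
  simp [pd, fderiv_fun_add hf hg]

theorem pd_neg (i : Fin n) : pd i (fun y => -f y) x = -pd i f x := by
  simp [pd]

theorem pd_const (c : ℝ) (i : Fin n) : pd i (fun _ => c) x = 0 := by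
  simp [pd]

theorem pd_mul (hf : DifferentiableAt ℝ f x) (hg : DifferentiableAt ℝ g x) (i : Fin n) :
    pd i (fun y => f y * g y) x = f x * pd i g x + g x * pd i f x := by
  simp [pd, fderiv_fun_mul hf hg]

theorem pd_const_mul (hf : DifferentiableAt ℝ f x) (c : ℝ) (i : Fin n) :
    pd i (fun y => c * f y) x = c * pd i f x := by
  simp [pd, fderiv_const_mul hf]

theorem pd_sq (hf : DifferentiableAt ℝ f x) (i : Fin n) :
    pd i (fun y => f y ^ 2) x = 2 * f x * pd i f x := by
  simp_rw [pow_two]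
  rw [pd_mul hf hf]; ring

theorem pd_sum {ι : Type*} {s : Finset ι} {F : ι → EuclideanSpace ℝ (Fin n) → ℝ}
    (hF : ∀ j ∈ s, DifferentiableAt ℝ (F j) x) (i : Fin n) :
    pd i (fun y => ∑ j ∈ s, F j y) x = ∑ j ∈ s, pd i (F j) x := by
  simp [pd, fderiv_fun_sum hF]

theorem pd_log (hf : DifferentiableAt ℝ f x) (hx : f x ≠ 0) (i : Fin n) :
    pd i (fun y => Real.log (f y)) x = pd i f x / f x := by
  simp [pd, fderiv.log hf hx]; ring

theorem pd_pd_eq (hf : ContDiff ℝ 2 f) (i j : Fin n) :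
    pd i (pd j f) x =
      fderiv ℝ (fderiv ℝ f) x (EuclideanSpace.single i 1) (EuclideanSpace.single j 1) := by
  have h : DifferentiableAt ℝ (fderiv ℝ f) x :=
    (hf.fderiv_right (m := 1) (by norm_num)).differentiable (by norm_num) x
  unfold pd
  rw [fderiv_clm_apply h (differentiableAt_const _)]
  simp

theorem pd_comm (hf : ContDiff ℝ 2 f) (i j : Fin n) (x : EuclideanSpace ℝ (Fin n)) :
    pd i (pd j f) x = pd j (pd i f) x := by
  rw [pd_pd_eq hf, pd_pd_eq hf]
  exact (hf.contDiffAt.isSymmSndFDerivAt (by simp)).eq _ _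

theorem laplacian_eq_sum_pd (hf : ContDiff ℝ 2 f) (x : EuclideanSpace ℝ (Fin n)) :
    Laplacian.laplacian f x = ∑ i, pd i (pd i f) x := by
  rw [InnerProductSpace.laplacian_eq_iteratedFDeriv_orthonormalBasis f
    (EuclideanSpace.basisFun (Fin n) ℝ)]
  simp only [pd_pd_eq hf, iteratedFDeriv_two_apply]
  simp

theorem norm_gradient_sq (f : EuclideanSpace ℝ (Fin n) → ℝ) (x : EuclideanSpace ℝ (Fin n)) :
    ‖gradient f x‖ ^ 2 = ∑ i, pd i f x ^ 2 := by
  rw [EuclideanSpace.norm_sq_eq]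
  refine Finset.sum_congr rfl fun i _ => ?_
  have : (gradient f x) i = pd i f x := by
    have h := InnerProductSpace.toDual_symm_apply (𝕜 := ℝ)
      (x := EuclideanSpace.single i (1 : ℝ)) (y := fderiv ℝ f x)
    rw [real_inner_comm, EuclideanSpace.inner_single_left] at h
    simpa [gradient, pd] using h
  rw [this, Real.norm_eq_abs, sq_abs]

theorem IsLocalMax.pd_eq_zero (h : IsLocalMax f x) (i : Fin n) : pd i f x = 0 := by
  simp [pd, h.fderiv_eq_zero]

/-- A positive second derivative would make the point a local minimum as well, hence the function
locally constant, forcing the second derivative to vanish. -/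
theorem deriv_deriv_nonpos_of_isLocalMax {g : ℝ → ℝ} {a : ℝ} (h : IsLocalMax g a)
    (hc : ContinuousAt g a) : deriv (deriv g) a ≤ 0 := by
  by_contra! hpos
  have hmin := isLocalMin_of_deriv_deriv_pos hpos h.deriv_eq_zero hc
  have hconst : g =ᶠ[nhds a] fun _ => g a := by
    filter_upwards [h, hmin] with y h1 h2 using le_antisymm h1 h2
  have h1 : deriv g =ᶠ[nhds a] fun _ => 0 := by
    simpa using hconst.deriv
  rw [h1.deriv_eq] at hpos
  simp at hpos

theorem IsLocalMax.pd_pd_nonpos (hf : ContDiff ℝ 2 f) (h : IsLocalMax f x) (i : Fin n) :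
    pd i (pd i f) x ≤ 0 := by
  have key : ∀ {k : EuclideanSpace ℝ (Fin n) → ℝ}, Differentiable ℝ k → ∀ t : ℝ,
      HasDerivAt (fun s : ℝ => k (x + s • EuclideanSpace.single i (1 : ℝ)))
        (pd i k (x + t • EuclideanSpace.single i (1 : ℝ))) t := by
    intro k hk t
    have h1 : HasDerivAt (fun s : ℝ => x + s • EuclideanSpace.single i (1 : ℝ))
        (EuclideanSpace.single i (1 : ℝ)) t := by
      simpa using ((hasDerivAt_id t).smul_const (EuclideanSpace.single i (1 : ℝ))).const_add x
    exact (hk _).hasFDerivAt.comp_hasDerivAt t h1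
  have hd : Differentiable ℝ f := hf.differentiable (by norm_num)
  have hd' : Differentiable ℝ (pd i f) :=
    (hf.pd (m := 2) (k := 1) (by norm_num) i).differentiable (by norm_num)
  have e1 : deriv (fun s : ℝ => f (x + s • EuclideanSpace.single i (1 : ℝ))) =
      fun t => pd i f (x + t • EuclideanSpace.single i (1 : ℝ)) :=
    funext fun t => (key hd t).deriv
  have hc : ContinuousAt (fun s : ℝ => x + s • EuclideanSpace.single i (1 : ℝ)) 0 := by fun_prop
  have hmax : IsLocalMax (fun s : ℝ => f (x + s • EuclideanSpace.single i (1 : ℝ))) 0 := by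
    have ht : Filter.Tendsto (fun s : ℝ => x + s • EuclideanSpace.single i (1 : ℝ)) (nhds 0)
        (nhds x) := by simpa using hc.tendsto
    simpa [IsLocalMax, IsMaxFilter] using ht.eventually h
  have := deriv_deriv_nonpos_of_isLocalMax hmax (key hd 0).continuousAt
  rw [e1, (key hd' 0).deriv] at this
  simpa using this

end PartialDerivatives

/-! ### Localized maximum principle for the drift Laplacian. -/

section MaximumPrinciple

variable {n : ℕ}

/-- The drift Laplacian `Δf + 2 ∇w · ∇f` in coordinates. -/
noncomputable def driftLaplacian (w f : EuclideanSpace ℝ (Fin n) → ℝ)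
    (x : EuclideanSpace ℝ (Fin n)) : ℝ :=
  ∑ i, (pd i (pd i f) x + 2 * pd i w x * pd i f x)

/-- The squared length of the gradient in coordinates. -/
noncomputable def gradSq (w : EuclideanSpace ℝ (Fin n) → ℝ) (x : EuclideanSpace ℝ (Fin n)) : ℝ :=
  ∑ i, pd i w x ^ 2

theorem gradSq_nonneg (w : EuclideanSpace ℝ (Fin n) → ℝ) (x : EuclideanSpace ℝ (Fin n)) :
    0 ≤ gradSq w x :=
  Finset.sum_nonneg fun _ _ => sq_nonneg _

/-- The first-order condition ψ∇F = −2F∇ψ eliminates ∇F from the second-order condition. The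
argument is coordinatewise, and no sign of F is needed. -/
theorem driftLaplacian_le_of_isLocalMax_sq_mul {w ψ F : EuclideanSpace ℝ (Fin n) → ℝ}
    {x : EuclideanSpace ℝ (Fin n)} (hψ : ContDiff ℝ 2 ψ) (hF : ContDiff ℝ 2 F) (hx : 0 < ψ x)
    (hmax : IsLocalMax (fun y => ψ y ^ 2 * F y) x) :
    ψ x ^ 2 * driftLaplacian w F x ≤ F x * ∑ i, (6 * pd i ψ x ^ 2 - 2 * ψ x * pd i (pd i ψ) x
      - 4 * ψ x * pd i w x * pd i ψ x) := by
  have dψ : Differentiable ℝ ψ := hψ.differentiable (by norm_num)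
  have dF : Differentiable ℝ F := hF.differentiable (by norm_num)
  have dψ' : ∀ i, Differentiable ℝ (pd i ψ) := fun i =>
    (hψ.pd (m := 2) (k := 1) (by norm_num) i).differentiable (by norm_num)
  have dF' : ∀ i, Differentiable ℝ (pd i F) := fun i =>
    (hF.pd (m := 2) (k := 1) (by norm_num) i).differentiable (by norm_num)
  rw [driftLaplacian, Finset.mul_sum, Finset.mul_sum]
  refine Finset.sum_le_sum fun i _ => ?_
  have e1 : pd i (fun y => ψ y ^ 2 * F y) =
      fun y => ψ y ^ 2 * pd i F y + F y * (2 * (ψ y * pd i ψ y)) := by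
    funext y
    rw [pd_mul ((dψ y).fun_pow 2) (dF y), pd_sq (dψ y)]
    ring
  have h1 := hmax.pd_eq_zero i
  have h2 := hmax.pd_pd_nonpos ((hψ.pow 2).mul hF) i
  rw [e1] at h1 h2
  rw [pd_add (((dψ x).fun_pow 2).fun_mul (dF' i x))
      ((dF x).fun_mul (((dψ x).fun_mul (dψ' i x)).const_mul 2)),
    pd_mul ((dψ x).fun_pow 2) (dF' i x), pd_sq (dψ x),
    pd_mul (dF x) (((dψ x).fun_mul (dψ' i x)).const_mul 2),
    pd_const_mul ((dψ x).fun_mul (dψ' i x)), pd_mul (dψ x) (dψ' i x)] at h2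
  have h3 : ψ x * pd i F x = -2 * F x * pd i ψ x := by
    have : ψ x * (ψ x * pd i F x - -2 * F x * pd i ψ x) = 0 := by linarith
    rcases mul_eq_zero.mp this with h | h
    · exact absurd h hx.ne'
    · linarith
  have h4 : ψ x * pd i ψ x * pd i F x = -2 * F x * pd i ψ x ^ 2 := by
    linear_combination pd i ψ x * h3
  have h5 : ψ x ^ 2 * pd i w x * pd i F x = -2 * F x * pd i ψ x * ψ x * pd i w x := by
    linear_combination ψ x * pd i w x * h3
  linarith

/-- The quadratic cutoff `1 - |y - x₀|² / R²`. -/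
noncomputable def quadraticCutoff (x₀ : EuclideanSpace ℝ (Fin n)) (R : ℝ)
    (y : EuclideanSpace ℝ (Fin n)) : ℝ :=
  1 - R⁻¹ ^ 2 * ‖y - x₀‖ ^ 2

theorem contDiff_quadraticCutoff (x₀ : EuclideanSpace ℝ (Fin n)) (R : ℝ) :
    ContDiff ℝ 2 (quadraticCutoff x₀ R) :=
  contDiff_const.sub (contDiff_const.mul ((contDiff_id.sub contDiff_const).norm_sq ℝ))

theorem pd_quadraticCutoff (x₀ : EuclideanSpace ℝ (Fin n)) (R : ℝ) (i : Fin n) :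
    pd i (quadraticCutoff x₀ R) = fun y => -2 * R⁻¹ ^ 2 * (y i - x₀ i) := by
  funext y
  have h : HasFDerivAt (quadraticCutoff x₀ R) _ y :=
    ((((hasFDerivAt_id y).sub_const x₀).norm_sq).const_mul (R⁻¹ ^ 2)).const_sub 1
  rw [pd, h.fderiv]
  simp [EuclideanSpace.inner_single_right]
  ring

theorem pd_pd_quadraticCutoff (x₀ : EuclideanSpace ℝ (Fin n)) (R : ℝ) (i : Fin n)
    (y : EuclideanSpace ℝ (Fin n)) :
    pd i (pd i (quadraticCutoff x₀ R)) y = -2 * R⁻¹ ^ 2 := by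
  rw [pd_quadraticCutoff]
  have h : HasFDerivAt (fun y : EuclideanSpace ℝ (Fin n) => -2 * R⁻¹ ^ 2 * (y i - x₀ i)) _ y :=
    (((EuclideanSpace.proj i : EuclideanSpace ℝ (Fin n) →L[ℝ] ℝ).hasFDerivAt (x := y)).sub_const (x₀ i)).const_mul (-2 * R⁻¹ ^ 2)
  rw [pd, h.fderiv]
  simp

/-- At an interior maximum of ψ²F, the term F²/(2n) must be controlled by the cutoff errors, K and
2F. The term F|∇w|²/n is there to absorb the cross term ∇w·∇ψ, about which nothing else is known. -/
theorem le_of_driftLaplacian_ge (hn : 1 ≤ n) {w F : EuclideanSpace ℝ (Fin n) → ℝ}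
    (hF : ContDiff ℝ 2 F) {x₀ : EuclideanSpace ℝ (Fin n)} {R K : ℝ} (hR : 0 < R) (hK : 0 ≤ K)
    (h : ∀ y ∈ Metric.closedBall x₀ R, 2 * n ≤ F y →
      F y ^ 2 / (2 * n) + F y * gradSq w y / n - 2 * F y - K ≤ driftLaplacian w F y) :
    F x₀ ≤ 4 * n + 80 * n ^ 2 * R⁻¹ ^ 2 + K / 2 := by
  have hn' : (1 : ℝ) ≤ n := by exact_mod_cast hn
  set ψ := quadraticCutoff x₀ R with hψdef
  have hψ : ContDiff ℝ 2 ψ := contDiff_quadraticCutoff x₀ R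
  set r := R⁻¹ with hr
  have hr0 : 0 < r := inv_pos.mpr hR
  have hrR : r * R = 1 := inv_mul_cancel₀ hR.ne'
  by_contra! hcon
  obtain ⟨y, hy, hymax⟩ := (isCompact_closedBall x₀ R).exists_isMaxOn
    ⟨x₀, Metric.mem_closedBall_self hR.le⟩
    (f := fun y => ψ y ^ 2 * F y) ((hψ.continuous.pow 2).mul hF.continuous).continuousOn
  have hψ0 : ψ x₀ = 1 := by simp [hψdef, quadraticCutoff]
  set X := ψ y ^ 2 * F y with hX
  have hFX : F x₀ ≤ X := by
    simpa [hψ0] using hymax (Metric.mem_closedBall_self hR.le)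
  have hXlb : 4 * n + 80 * n ^ 2 * r ^ 2 + K / 2 < X := hcon.trans_le hFX
  have hq0 : 0 ≤ 80 * (n : ℝ) ^ 2 * r ^ 2 := by positivity
  have hXn : 4 * n < X := by linarith
  have hX0 : 0 < X := by linarith
  have hs : r * ‖y - x₀‖ ≤ 1 := by
    rw [mem_closedBall_iff_norm] at hy
    rw [← hrR]; gcongr
  have hs' : r ^ 2 * ‖y - x₀‖ ^ 2 ≤ 1 := by
    rw [← mul_pow]; exact pow_le_one₀ (by positivity) hs
  have hψy : ψ y = 1 - r ^ 2 * ‖y - x₀‖ ^ 2 := rfl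
  have hψ_ne : ψ y ≠ 0 := by
    intro h0; rw [hX, h0] at hX0; simp at hX0
  have hψ_pos : 0 < ψ y := lt_of_le_of_ne (by linarith) hψ_ne.symm
  have hψ_le : ψ y ≤ 1 := by rw [hψy]; linarith [show 0 ≤ r ^ 2 * ‖y - x₀‖ ^ 2 by positivity]
  have hψ2 : ψ y ^ 2 ≤ 1 := pow_le_one₀ hψ_pos.le hψ_le
  have hF0 : 0 < F y := by
    by_contra! hneg
    have : X ≤ 0 := mul_nonpos_of_nonneg_of_nonpos (by positivity) hneg
    linarith
  have hXF : X ≤ F y := by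
    rw [hX]; exact mul_le_of_le_one_left hF0.le hψ2
  have hyint : y ∈ Metric.ball x₀ R := by
    rw [mem_ball_iff_norm]
    by_contra! hge
    have : 1 ≤ r * ‖y - x₀‖ := by rw [← hrR]; gcongr
    have : 1 ≤ r ^ 2 * ‖y - x₀‖ ^ 2 := by rw [← mul_pow]; exact one_le_pow₀ this
    linarith
  have hloc : IsLocalMax (fun y => ψ y ^ 2 * F y) y :=
    (hymax.on_subset Metric.ball_subset_closedBall).isLocalMax (Metric.isOpen_ball.mem_nhds hyint)
  have h1 := driftLaplacian_le_of_isLocalMax_sq_mul (w := w) hψ hF hψ_pos hloc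
  have h2 := h y hy (by linarith)
  have hsum : ∑ i, (6 * pd i ψ y ^ 2 - 2 * ψ y * pd i (pd i ψ) y - 4 * ψ y * pd i w y * pd i ψ y) ≤
      40 * n * r ^ 2 + ψ y ^ 2 * gradSq w y / n := by
    have hnorm : ‖y - x₀‖ ^ 2 = ∑ i, (y i - x₀ i) ^ 2 := by
      rw [EuclideanSpace.norm_sq_eq]; simp
    have hterm : ∀ i, 6 * pd i ψ y ^ 2 - 2 * ψ y * pd i (pd i ψ) y
        - 4 * ψ y * pd i w y * pd i ψ y ≤
        (24 + 16 * n) * r ^ 4 * (y i - x₀ i) ^ 2 + 4 * ψ y * r ^ 2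
          + ψ y ^ 2 * pd i w y ^ 2 / n := by
      intro i
      rw [pd_pd_quadraticCutoff, pd_quadraticCutoff]
      -- Completing the square with weight n: the cross term 4ψ ∂ᵢw ∂ᵢψ costs exactly ψ²(∂ᵢw)²/n,
      -- matching the available gradient term, plus 4n(∂ᵢψ)².
      have h0 : 0 ≤ (ψ y * pd i w y + 2 * n * (-2 * r ^ 2 * (y i - x₀ i))) ^ 2 / n := by positivity
      have e : (ψ y * pd i w y + 2 * n * (-2 * r ^ 2 * (y i - x₀ i))) ^ 2 / n =
          ψ y ^ 2 * pd i w y ^ 2 / n + 4 * ψ y * pd i w y * (-2 * r ^ 2 * (y i - x₀ i))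
            + 16 * n * r ^ 4 * (y i - x₀ i) ^ 2 := by
        field_simp; ring
      rw [e] at h0
      simp only [← hr]
      linarith
    refine (Finset.sum_le_sum fun i _ => hterm i).trans ?_
    have hg : ∑ i, ψ y ^ 2 * pd i w y ^ 2 / n = ψ y ^ 2 * gradSq w y / n := by
      rw [gradSq, Finset.mul_sum, Finset.sum_div]
    rw [Finset.sum_add_distrib, Finset.sum_add_distrib, ← Finset.mul_sum, ← hnorm, hg,
      Finset.sum_const, Finset.card_univ, Fintype.card_fin, nsmul_eq_mul]
    -- For the quadratic cutoff, r²|y − x₀|² = 1 − ψ. The total (24 + 16n)(1 − ψ)r² + 4nψr² is then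
    -- at most 40nr² because n ≥ 1.
    have e : (24 + 16 * n) * r ^ 4 * ‖y - x₀‖ ^ 2 = (24 + 16 * n) * r ^ 2 * (1 - ψ y) := by
      rw [hψy]; ring
    rw [e]
    have : 0 ≤ ψ y * ((n : ℝ) - 1) * r ^ 2 := by
      have := hψ_pos.le; have : (0:ℝ) ≤ n - 1 := by linarith
      positivity
    have : 0 ≤ (1 - ψ y) * ((n : ℝ) - 1) * r ^ 2 := by
      have : (0:ℝ) ≤ n - 1 := by linarith
      have : 0 ≤ 1 - ψ y := by linarith
      positivity
    nlinarith [show 0 ≤ ψ y * r ^ 2 * n by positivity]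
  have h3 : ψ y ^ 2 * (F y ^ 2 / (2 * n) + F y * gradSq w y / n - 2 * F y - K) ≤
      F y * (40 * n * r ^ 2 + ψ y ^ 2 * gradSq w y / n) :=
    (mul_le_mul_of_nonneg_left h2 (by positivity)).trans
      (h1.trans (mul_le_mul_of_nonneg_left hsum hF0.le))
  have h4 : F y * (X / (2 * n) - 2 * ψ y ^ 2 - 40 * n * r ^ 2) ≤ ψ y ^ 2 * K := by
    have e : F y * (X / (2 * n) - 2 * ψ y ^ 2 - 40 * n * r ^ 2) - ψ y ^ 2 * K =
        ψ y ^ 2 * (F y ^ 2 / (2 * n) + F y * gradSq w y / n - 2 * F y - K) -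
          F y * (40 * n * r ^ 2 + ψ y ^ 2 * gradSq w y / n) := by
      rw [hX]; field_simp; ring
    linarith
  have h5 : K / (4 * n) < X / (2 * n) - 2 - 40 * n * r ^ 2 := by
    have : X / (2 * n) - 2 - 40 * n * r ^ 2 - K / (4 * n) =
        (X - (4 * n + 80 * n ^ 2 * r ^ 2 + K / 2)) / (2 * n) := by
      field_simp; ring
    have : 0 < (X - (4 * n + 80 * n ^ 2 * r ^ 2 + K / 2)) / (2 * n) :=
      div_pos (by linarith) (by positivity)
    linarith
  -- The assumed failure of the bound gives F y ≥ X > 4n, which upgrades `h5` to a contradiction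
  -- with `h4`.
  have h6 : K < F y * (X / (2 * n) - 2 * ψ y ^ 2 - 40 * n * r ^ 2) := by
    have hpos : 0 ≤ K / (4 * n) := by positivity
    calc K = 4 * n * (K / (4 * n)) := by field_simp
      _ ≤ F y * (K / (4 * n)) := by gcongr; linarith
      _ < F y * (X / (2 * n) - 2 - 40 * n * r ^ 2) := by gcongr
      _ ≤ _ := by gcongr; linarith
  have : ψ y ^ 2 * K ≤ K := mul_le_of_le_one_left hK hψ2
  linarith

end MaximumPrinciple

/-! ### Bochner's formula and the Bernstein estimate for C³ functions. -/

section Bernstein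

variable {n : ℕ} {w W : EuclideanSpace ℝ (Fin n) → ℝ}

/-- The potential `U` for which `w` solves `Δw + |∇w|² + 2 w + U = 0`. -/
noncomputable def logPotential (w : EuclideanSpace ℝ (Fin n) → ℝ)
    (x : EuclideanSpace ℝ (Fin n)) : ℝ :=
  -(∑ i, pd i (pd i w) x + gradSq w x + 2 * w x)

theorem pd_gradSq (hw : ContDiff ℝ 2 w) (i : Fin n) :
    pd i (gradSq w) = fun y => ∑ j, 2 * (pd j w y * pd i (pd j w) y) := by
  have d : ∀ j, Differentiable ℝ (pd j w) := fun j =>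
    (hw.pd (m := 2) (k := 1) (by norm_num) j).differentiable (by norm_num)
  funext y
  unfold gradSq
  rw [pd_sum fun j _ => (d j y).fun_pow 2]
  refine Finset.sum_congr rfl fun j _ => ?_
  rw [pd_sq (d j y)]; ring

theorem contDiff_gradSq {m k : ℕ∞} (hw : ContDiff ℝ m w) (hk : k + 1 ≤ m) :
    ContDiff ℝ k (gradSq w) :=
  ContDiff.sum fun i _ => (hw.pd hk i).pow 2

theorem pd_pd_gradSq (hw : ContDiff ℝ 3 w) (i : Fin n) (x : EuclideanSpace ℝ (Fin n)) :
    pd i (pd i (gradSq w)) x =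
      ∑ j, (2 * pd i (pd j w) x ^ 2 + 2 * (pd j w x * pd i (pd i (pd j w)) x)) := by
  have c : ∀ j, ContDiff ℝ 2 (pd j w) := fun j => hw.pd (m := 3) (k := 2) (by norm_num) j
  have d : ∀ j, Differentiable ℝ (pd j w) := fun j => (c j).differentiable (by norm_num)
  have d2 : ∀ j, Differentiable ℝ (pd i (pd j w)) := fun j =>
    ((c j).pd (m := 2) (k := 1) (by norm_num) i).differentiable (by norm_num)
  rw [pd_gradSq (hw.of_le (by norm_num)),
    pd_sum fun j _ => ((d j x).fun_mul (d2 j x)).const_mul 2]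
  refine Finset.sum_congr rfl fun j _ => ?_
  rw [pd_const_mul ((d j x).fun_mul (d2 j x)), pd_mul (d j x) (d2 j x)]; ring

theorem pd_logPotential (hw : ContDiff ℝ 3 w) (j : Fin n) (x : EuclideanSpace ℝ (Fin n)) :
    pd j (logPotential w) x =
      -(∑ i, pd i (pd i (pd j w)) x + ∑ i, 2 * (pd i w x * pd j (pd i w) x) + 2 * pd j w x) := by
  have c : ∀ j, ContDiff ℝ 2 (pd j w) := fun j => hw.pd (m := 3) (k := 2) (by norm_num) j
  have d2 : ∀ i, Differentiable ℝ (pd i (pd i w)) := fun i =>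
    ((c i).pd (m := 2) (k := 1) (by norm_num) i).differentiable (by norm_num)
  have dg : Differentiable ℝ (gradSq w) :=
    (contDiff_gradSq (m := 3) (k := 2) hw (by norm_num)).differentiable (by norm_num)
  have dw : Differentiable ℝ w := hw.differentiable (by norm_num)
  have hw2 : ContDiff ℝ 2 w := hw.of_le (by norm_num)
  have ds : DifferentiableAt ℝ (fun y => ∑ i, pd i (pd i w) y) x :=
    DifferentiableAt.fun_sum fun i _ => d2 i x
  unfold logPotential
  rw [pd_neg, pd_add (ds.fun_add (dg x)) ((dw x).const_mul 2), pd_add ds (dg x),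
    pd_sum fun i _ => d2 i x, pd_gradSq hw2, pd_const_mul (dw x)]
  congr 3
  refine Finset.sum_congr rfl fun i _ => ?_
  rw [pd_comm (c i) j i, show pd j (pd i w) = pd i (pd j w) from funext (pd_comm hw2 j i)]

/-- Bochner's formula for `|∇w|² + 4 w + W`. -/
theorem driftLaplacian_gradSq_add (hw : ContDiff ℝ 3 w) (hW : ContDiff ℝ 2 W)
    (x : EuclideanSpace ℝ (Fin n)) :
    driftLaplacian w (fun y => gradSq w y + 4 * w y + W y) x =
      2 * (∑ i, ∑ j, pd i (pd j w) x ^ 2) - 8 * w x - 4 * logPotential w x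
        + ∑ i, pd i (pd i W) x
        + 2 * ∑ i, pd i w x * (pd i W x - pd i (logPotential w) x) := by
  have c : ∀ j, ContDiff ℝ 2 (pd j w) := fun j => hw.pd (m := 3) (k := 2) (by norm_num) j
  have cg : ContDiff ℝ 2 (gradSq w) := contDiff_gradSq (m := 3) (k := 2) hw (by norm_num)
  have dg : Differentiable ℝ (gradSq w) := cg.differentiable (by norm_num)
  have dg' : ∀ i, Differentiable ℝ (pd i (gradSq w)) := fun i =>
    (cg.pd (m := 2) (k := 1) (by norm_num) i).differentiable (by norm_num)
  have dw : Differentiable ℝ w := hw.differentiable (by norm_num)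
  have dw' : ∀ i, Differentiable ℝ (pd i w) := fun i => (c i).differentiable (by norm_num)
  have dW : Differentiable ℝ W := hW.differentiable (by norm_num)
  have dW' : ∀ i, Differentiable ℝ (pd i W) := fun i =>
    (hW.pd (m := 2) (k := 1) (by norm_num) i).differentiable (by norm_num)
  have e1 : ∀ i, pd i (fun y => gradSq w y + 4 * w y + W y) =
      fun y => pd i (gradSq w) y + 4 * pd i w y + pd i W y := fun i => by
    funext y
    rw [pd_add ((dg y).fun_add ((dw y).const_mul 4)) (dW y),
      pd_add (dg y) ((dw y).const_mul 4), pd_const_mul (dw y)]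
  have e2 : ∀ i, pd i (pd i (fun y => gradSq w y + 4 * w y + W y)) x =
      pd i (pd i (gradSq w)) x + 4 * pd i (pd i w) x + pd i (pd i W) x := fun i => by
    rw [e1, pd_add ((dg' i x).fun_add ((dw' i x).const_mul 4)) (dW' i x),
      pd_add (dg' i x) ((dw' i x).const_mul 4), pd_const_mul (dw' i x)]
  -- Reordering isolates Δ∂ⱼw, the only third-order quantity, which the differentiated equation
  -- expresses by lower-order terms.
  have swap : ∑ i, ∑ j, pd j w x * pd i (pd i (pd j w)) x =
      ∑ j, pd j w x * ∑ i, pd i (pd i (pd j w)) x := by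
    rw [Finset.sum_comm]
    exact Finset.sum_congr rfl fun j _ => (Finset.mul_sum _ _ _).symm
  have third : ∀ j, ∑ i, pd i (pd i (pd j w)) x =
      -pd j (logPotential w) x - ∑ i, 2 * (pd i w x * pd j (pd i w) x) - 2 * pd j w x :=
    fun j => by rw [pd_logPotential hw]; ring
  have hU : logPotential w x = -(∑ i, pd i (pd i w) x + gradSq w x + 2 * w x) := rfl
  have hp : gradSq w x = ∑ i, pd i w x ^ 2 := rfl
  simp only [driftLaplacian, e2, pd_pd_gradSq hw]
  simp only [e1, pd_gradSq (hw.of_le (by norm_num : (2 : WithTop ℕ∞) ≤ 3))]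
  simp only [third] at swap
  rw [hU, hp]
  have expand : ∑ i, (∑ j, (2 * pd i (pd j w) x ^ 2 + 2 * (pd j w x * pd i (pd i (pd j w)) x))
      + 4 * pd i (pd i w) x + pd i (pd i W) x
      + 2 * pd i w x * (∑ j, 2 * (pd j w x * pd i (pd j w) x) + 4 * pd i w x + pd i W x)) =
      2 * (∑ i, ∑ j, pd i (pd j w) x ^ 2)
        + 2 * (∑ i, ∑ j, pd j w x * pd i (pd i (pd j w)) x)
        + 4 * ∑ i, pd i (pd i w) x + ∑ i, pd i (pd i W) x
        + 2 * ∑ i, pd i w x * ∑ j, 2 * (pd j w x * pd i (pd j w) x)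
        + 8 * ∑ i, pd i w x ^ 2 + 2 * ∑ i, pd i w x * pd i W x := by
    simp only [Finset.sum_add_distrib, Finset.mul_sum, mul_add]
    simp only [← Finset.sum_add_distrib]
    refine Finset.sum_congr rfl fun i _ => ?_
    ring_nf
  rw [expand, swap]
  simp only [mul_sub, Finset.sum_sub_distrib, mul_neg, Finset.sum_neg_distrib]
  have e3 : ∑ i, pd i w x * (2 * pd i w x) = 2 * ∑ i, pd i w x ^ 2 := by
    rw [Finset.mul_sum]; exact Finset.sum_congr rfl fun i _ => by ring
  rw [e3]
  ring

/-- Cauchy–Schwarz on the diagonal of the Hessian; the off-diagonal squares are discarded. -/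
theorem sq_sum_pd_pd_le (w : EuclideanSpace ℝ (Fin n) → ℝ) (x : EuclideanSpace ℝ (Fin n)) :
    (∑ i, pd i (pd i w) x) ^ 2 ≤ n * ∑ i, ∑ j, pd i (pd j w) x ^ 2 := by
  refine (sq_sum_le_card_mul_sum_sq (s := Finset.univ)).trans ?_
  rw [Finset.card_univ, Fintype.card_fin]
  gcongr with i
  exact Finset.single_le_sum (f := fun j => pd i (pd j w) x ^ 2)
    (fun _ _ => sq_nonneg _) (Finset.mem_univ i)

/-- Interior upper bound for `w` by the Bernstein method: here `W` is an auxiliary potential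
to be compared with the actual one. -/
theorem le_of_logPotential_bounds (hn : 1 ≤ n) (hw : ContDiff ℝ 3 w) (hW : ContDiff ℝ 2 W)
    {x₀ : EuclideanSpace ℝ (Fin n)} {R K D : ℝ} (hR : 0 < R) (hK : 0 ≤ K) (hW₀ : 0 ≤ W x₀)
    (hWU : ∀ y ∈ Metric.closedBall x₀ R, W y ≤ 2 * logPotential w y)
    (hΔ : ∀ y ∈ Metric.closedBall x₀ R, -K ≤ ∑ i, pd i (pd i W) y)
    (hD : ∀ y ∈ Metric.closedBall x₀ R,
      ∑ i, (pd i W y - pd i (logPotential w) y) ^ 2 ≤ D) :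
    w x₀ ≤ n + 20 * n ^ 2 * R⁻¹ ^ 2 + K / 8 + D / 16 := by
  have hn' : (1 : ℝ) ≤ n := by exact_mod_cast hn
  set F := fun y => gradSq w y + 4 * w y + W y with hFdef
  have hF : ContDiff ℝ 2 F :=
    ((contDiff_gradSq (m := 3) (k := 2) hw (by norm_num)).add
      (contDiff_const.mul (hw.of_le (by norm_num)))).add hW
  have hD0 : 0 ≤ D := (Finset.sum_nonneg fun _ _ => sq_nonneg _).trans
    (hD x₀ (Metric.mem_closedBall_self hR.le))
  have key := le_of_driftLaplacian_ge hn (w := w) hF hR (K := K + D / 2) (by positivity) (x₀ := x₀) ?_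
  · have : F x₀ = gradSq w x₀ + 4 * w x₀ + W x₀ := rfl
    linarith [gradSq_nonneg w x₀]
  intro y hy hFy
  rw [driftLaplacian_gradSq_add hw hW]
  have h1 := sq_sum_pd_pd_le w y
  have h2 := hWU y hy
  have h3 := hΔ y hy
  have h4 := hD y hy
  have hp := gradSq_nonneg w y
  have hFe : F y = gradSq w y + 4 * w y + W y := rfl
  have hUe : logPotential w y = -(∑ i, pd i (pd i w) y + gradSq w y + 2 * w y) := rfl
  set p := gradSq w y
  set S := ∑ i, ∑ j, pd i (pd j w) y ^ 2
  set L := ∑ i, pd i (pd i w) y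
  set U := logPotential w y
  -- The loss 2p is exactly the 2|∇w|² gained on rewriting −8w − 4U as −2F + 2p − 2(2U − W).
  have h5 : -(2 * p) - D / 2 ≤ 2 * ∑ i, pd i w y * (pd i W y - pd i (logPotential w) y) := by
    have : ∑ i, (-(2 * pd i w y ^ 2) - (pd i W y - pd i (logPotential w) y) ^ 2 / 2) ≤
        ∑ i, 2 * (pd i w y * (pd i W y - pd i (logPotential w) y)) := by
      refine Finset.sum_le_sum fun i _ => ?_
      nlinarith [sq_nonneg (2 * pd i w y + (pd i W y - pd i (logPotential w) y))]
    rw [Finset.sum_sub_distrib, Finset.sum_neg_distrib, ← Finset.mul_sum, ← Finset.sum_div,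
      ← Finset.mul_sum] at this
    have e : ∑ i, pd i w y ^ 2 = p := rfl
    rw [e] at this
    linarith
  have hq : 0 ≤ 2 * U - W y := by linarith
  have hL : -L = F y / 2 + p / 2 + (2 * U - W y) / 2 := by rw [hFe, hUe]; ring
  have hF0 : 0 ≤ F y := by linarith
  have h6 : F y ^ 2 / 4 + F y * p / 2 + F y * (2 * U - W y) / 2 ≤ n * S := by
    refine le_trans ?_ h1
    have : L ^ 2 = (F y / 2 + p / 2 + (2 * U - W y) / 2) ^ 2 := by rw [← hL]; ring
    rw [this]
    nlinarith [mul_nonneg hp hq, sq_nonneg (p + (2 * U - W y))]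
  -- Here F ≥ 2n is used: F(2U − W)/n dominates 2(2U − W), which cancels the remaining potential
  -- term in Bochner's formula.
  have h7 : F y ^ 2 / (2 * n) + F y * p / n + 2 * (2 * U - W y) ≤ 2 * S := by
    have a : F y ^ 2 / (2 * n) + F y * p / n + F y * (2 * U - W y) / n ≤ 2 * S := by
      have : F y ^ 2 / (2 * n) + F y * p / n + F y * (2 * U - W y) / n =
          2 * (F y ^ 2 / 4 + F y * p / 2 + F y * (2 * U - W y) / 2) / n := by field_simp; ring
      rw [this, div_le_iff₀ (by linarith)]
      linarith
    have b : 2 * (2 * U - W y) ≤ F y * (2 * U - W y) / n := by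
      rw [le_div_iff₀ (by linarith)]
      nlinarith
    linarith
  linarith

end Bernstein

/-! ### Approximation by smooth functions with control of the potential in C¹. -/

section Mollification

open MeasureTheory Filter Topology
open scoped Convolution

variable {n : ℕ} {g w : EuclideanSpace ℝ (Fin n) → ℝ}

/-- The convolution of `g` with a normalized smooth bump function. -/
noncomputable def mollify (φ : ContDiffBump (0 : EuclideanSpace ℝ (Fin n)))
    (g : EuclideanSpace ℝ (Fin n) → ℝ) (x : EuclideanSpace ℝ (Fin n)) : ℝ :=
  ∫ t, φ.normed volume t * g (x - t)

theorem mollify_eq_convolution (φ : ContDiffBump (0 : EuclideanSpace ℝ (Fin n)))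
    (g : EuclideanSpace ℝ (Fin n) → ℝ) :
    mollify φ g = φ.normed volume ⋆[ContinuousLinearMap.lsmul ℝ ℝ, volume] g := rfl

theorem contDiff_mollify (φ : ContDiffBump (0 : EuclideanSpace ℝ (Fin n))) (hg : Continuous g)
    {m : ℕ∞} : ContDiff ℝ m (mollify φ g) := by
  rw [mollify_eq_convolution]
  exact φ.hasCompactSupport_normed.contDiff_convolution_left _ φ.contDiff_normed
    hg.locallyIntegrable

theorem integrable_mollify (φ : ContDiffBump (0 : EuclideanSpace ℝ (Fin n)))
    {E' : Type*} [NormedAddCommGroup E'] [NormedSpace ℝ E']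
    {g : EuclideanSpace ℝ (Fin n) → E'} (hg : Continuous g) (x : EuclideanSpace ℝ (Fin n)) :
    Integrable (fun t => φ.normed volume t • g (x - t)) := by
  have hc : Continuous fun t => φ.normed volume t • g (x - t) :=
    φ.continuous_normed.smul (hg.comp (continuous_const.sub continuous_id))
  exact hc.integrable_of_hasCompactSupport φ.hasCompactSupport_normed.smul_right

theorem mollify_sum {ι : Type*} (s : Finset ι)
    (φ : ContDiffBump (0 : EuclideanSpace ℝ (Fin n))) {G : ι → EuclideanSpace ℝ (Fin n) → ℝ}
    (hG : ∀ i ∈ s, Continuous (G i)) (x : EuclideanSpace ℝ (Fin n)) :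
    mollify φ (fun y => ∑ i ∈ s, G i y) x = ∑ i ∈ s, mollify φ (G i) x := by
  unfold mollify
  simp_rw [Finset.mul_sum]
  exact integral_finsetSum _ fun i hi => integrable_mollify φ (hG i hi) x

theorem pd_mollify (φ : ContDiffBump (0 : EuclideanSpace ℝ (Fin n))) (hg : ContDiff ℝ 1 g)
    (i : Fin n) : pd i (mollify φ g) = mollify φ (pd i g) := by
  funext x
  have hg' : Continuous (fderiv ℝ g) := hg.continuous_fderiv (by norm_num)
  obtain ⟨C, hC⟩ := (isCompact_closedBall x (1 + φ.rOut)).exists_bound_of_continuousOn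
    hg'.continuousOn
  have hbound : ∀ t, ∀ y ∈ Metric.ball x 1,
      ‖φ.normed volume t • fderiv ℝ g (y - t)‖ ≤ φ.normed volume t * C := by
    intro t y hy
    rw [norm_smul, Real.norm_of_nonneg (φ.nonneg_normed t)]
    by_cases ht : t ∈ Metric.ball (0 : EuclideanSpace ℝ (Fin n)) φ.rOut
    · refine mul_le_mul_of_nonneg_left (hC _ ?_) (φ.nonneg_normed t)
      rw [mem_ball_iff_norm] at hy ht
      rw [mem_closedBall_iff_norm, show y - t - x = (y - x) - (t - 0) by abel]
      exact (norm_sub_le _ _).trans (by linarith)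
    · rw [← φ.support_normed_eq (μ := volume), Function.notMem_support] at ht
      simp [ht]
  have h := hasFDerivAt_integral_of_dominated_of_fderiv_le (μ := volume)
    (F := fun y t => φ.normed volume t * g (y - t))
    (F' := fun y t => φ.normed volume t • fderiv ℝ g (y - t))
    (bound := fun t => φ.normed volume t * C) (x₀ := x)
    (Metric.ball_mem_nhds x one_pos)
    (Eventually.of_forall fun y => (integrable_mollify φ hg.continuous y).aestronglyMeasurable)
    (integrable_mollify φ hg.continuous x)
    (integrable_mollify φ hg' x).aestronglyMeasurable
    (Eventually.of_forall hbound)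
    (φ.integrable_normed.mul_const C)
    (Eventually.of_forall fun t y _ => by
      have h1 : HasFDerivAt g (fderiv ℝ g (y - t)) (y - t) :=
        (hg.differentiable (by norm_num) _).hasFDerivAt
      simpa using (h1.comp y ((hasFDerivAt_id y).sub_const t)).const_mul (φ.normed volume t))
  rw [pd, show mollify φ g = fun y => ∫ t, φ.normed volume t * g (y - t) from rfl, h.fderiv,
    ContinuousLinearMap.integral_apply (integrable_mollify φ hg' x)]
  rfl

/-- The limit is joint in the index and the point, so that compactness later turns it into uniform
convergence on balls. -/
theorem tendsto_mollify {φ : ℕ → ContDiffBump (0 : EuclideanSpace ℝ (Fin n))}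
    (hφ : Tendsto (fun k => (φ k).rOut) atTop (𝓝 0)) (hg : Continuous g)
    (x : EuclideanSpace ℝ (Fin n)) :
    Tendsto (fun q : ℕ × EuclideanSpace ℝ (Fin n) => mollify (φ q.1) g q.2) (atTop ×ˢ 𝓝 x)
      (𝓝 (g x)) := by
  simp_rw [mollify_eq_convolution]
  exact ContDiffBump.convolution_tendsto_right (φ := fun q : ℕ × EuclideanSpace ℝ (Fin n) => φ q.1)
    (g := fun _ => g) (hφ.comp tendsto_fst)
    (Eventually.of_forall fun _ => hg.aestronglyMeasurable)
    ((hg.tendsto x).comp tendsto_snd) tendsto_snd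

theorem logPotential_mollify (φ : ContDiffBump (0 : EuclideanSpace ℝ (Fin n)))
    (hw : ContDiff ℝ 2 w) :
    logPotential (mollify φ w) = fun y =>
      -(mollify φ (fun z => ∑ i, pd i (pd i w) z) y + ∑ i, mollify φ (pd i w) y ^ 2
        + 2 * mollify φ w y) := by
  have c : ∀ i, ContDiff ℝ 1 (pd i w) := fun i => hw.pd (m := 2) (k := 1) (by norm_num) i
  have c' : ∀ i, ContDiff ℝ 0 (pd i (pd i w)) := fun i =>
    (c i).pd (m := 1) (k := 0) (by norm_num) i
  funext y
  rw [mollify_sum _ φ fun i _ => (c' i).continuous]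
  simp only [logPotential, gradSq, pd_mollify φ (hw.of_le (by norm_num)), pd_mollify φ (c _)]

/-- Third derivatives of w occur only through ∂ⱼΔw, which is continuous by assumption even though
individual third derivatives need not exist. -/
theorem pd_logPotential_mollify (φ : ContDiffBump (0 : EuclideanSpace ℝ (Fin n)))
    (hw : ContDiff ℝ 2 w) (hL : ContDiff ℝ 1 fun z => ∑ i, pd i (pd i w) z) (j : Fin n)
    (y : EuclideanSpace ℝ (Fin n)) :
    pd j (logPotential (mollify φ w)) y =
      -(mollify φ (pd j fun z => ∑ i, pd i (pd i w) z) y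
        + ∑ i, 2 * mollify φ (pd i w) y * mollify φ (pd j (pd i w)) y
        + 2 * mollify φ (pd j w) y) := by
  have c : ∀ i, ContDiff ℝ 1 (pd i w) := fun i => hw.pd (m := 2) (k := 1) (by norm_num) i
  have d : ∀ {f : EuclideanSpace ℝ (Fin n) → ℝ}, Continuous f → Differentiable ℝ (mollify φ f) :=
    fun hf => (contDiff_mollify φ hf (m := 1)).differentiable (by norm_num)
  have d1 := d hL.continuous y
  have d2 : ∀ i, DifferentiableAt ℝ (mollify φ (pd i w)) y := fun i => d (c i).continuous y
  have d3 := d hw.continuous y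
  have d4 : DifferentiableAt ℝ (fun y => ∑ i, mollify φ (pd i w) y ^ 2) y :=
    DifferentiableAt.fun_sum fun i _ => (d2 i).fun_pow 2
  rw [logPotential_mollify φ hw, pd_neg, pd_add (d1.fun_add d4) (d3.const_mul 2), pd_add d1 d4,
    pd_sum fun i _ => (d2 i).fun_pow 2, pd_const_mul d3, pd_mollify φ hL,
    pd_mollify φ (hw.of_le (by norm_num))]
  simp only [pd_sq (d2 _), pd_mollify φ (c _)]

theorem pd_logPotential_eq (hw : ContDiff ℝ 2 w)
    (hL : ContDiff ℝ 1 fun z => ∑ i, pd i (pd i w) z) (j : Fin n)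
    (y : EuclideanSpace ℝ (Fin n)) :
    pd j (logPotential w) y =
      -(pd j (fun z => ∑ i, pd i (pd i w) z) y + ∑ i, 2 * pd i w y * pd j (pd i w) y
        + 2 * pd j w y) := by
  have d1 := hL.differentiable (by norm_num) y
  have d2 : ∀ i, DifferentiableAt ℝ (pd i w) y := fun i =>
    (hw.pd (m := 2) (k := 1) (by norm_num) i).differentiable (by norm_num) y
  have d3 := hw.differentiable (by norm_num) y
  have d4 : DifferentiableAt ℝ (gradSq w) y :=
    DifferentiableAt.fun_sum fun i _ => (d2 i).fun_pow 2
  unfold logPotential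
  rw [pd_neg, pd_add (d1.fun_add d4) (d3.const_mul 2), pd_add d1 d4, pd_const_mul d3,
    pd_gradSq hw]
  simp only [mul_assoc]

/-- A `C²` function `w` whose potential `-(Δw + |∇w|² + 2 w)` is `C¹` is approximated by smooth
functions in such a way that the potentials converge in `C¹`, uniformly on balls. -/
theorem exists_contDiff_approx (hw : ContDiff ℝ 2 w) (hU : ContDiff ℝ 1 (logPotential w))
    (x₀ : EuclideanSpace ℝ (Fin n)) (R : ℝ) {δ : ℝ} (hδ : 0 < δ) :
    ∃ v : EuclideanSpace ℝ (Fin n) → ℝ, ContDiff ℝ 3 v ∧ ∀ y ∈ Metric.closedBall x₀ R,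
      |v y - w y| < δ ∧ |logPotential v y - logPotential w y| < δ ∧
        ∑ j, (pd j (logPotential v) y - pd j (logPotential w) y) ^ 2 < δ := by
  have c : ∀ i, ContDiff ℝ 1 (pd i w) := fun i => hw.pd (m := 2) (k := 1) (by norm_num) i
  have c' : ∀ i j, Continuous (pd j (pd i w)) := fun i j =>
    ((c i).pd (m := 1) (k := 0) (by norm_num) j).continuous
  have hL : ContDiff ℝ 1 fun z => ∑ i, pd i (pd i w) z := by
    have e : (fun z => ∑ i, pd i (pd i w) z) = fun z => -logPotential w z - gradSq w z - 2 * w z := by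
      funext z; simp only [logPotential]; ring
    rw [e]
    exact (hU.neg.sub (contDiff_gradSq (m := 2) (k := 1) hw (by norm_num))).sub
      (contDiff_const.mul (hw.of_le (by norm_num)))
  have hL' : ∀ j, Continuous (pd j fun z => ∑ i, pd i (pd i w) z) := fun j =>
    (hL.pd (m := 1) (k := 0) (by norm_num) j).continuous
  have cU : ∀ j, Continuous (pd j (logPotential w)) := fun j =>
    (hU.pd (m := 1) (k := 0) (by norm_num) j).continuous
  let φ : ℕ → ContDiffBump (0 : EuclideanSpace ℝ (Fin n)) := fun k =>
    ⟨1 / (k + 1) / 2, 1 / (k + 1), by positivity, half_lt_self (by positivity)⟩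
  have hφ : Tendsto (fun k => (φ k).rOut) atTop (𝓝 0) := tendsto_one_div_add_atTop_nhds_zero_nat
  have t : ∀ {f : EuclideanSpace ℝ (Fin n) → ℝ}, Continuous f → ∀ x, Tendsto
      (fun q : ℕ × EuclideanSpace ℝ (Fin n) => mollify (φ q.1) f q.2) (atTop ×ˢ 𝓝 x) (𝓝 (f x)) :=
    fun hf x => tendsto_mollify hφ hf x
  have s : ∀ {f : EuclideanSpace ℝ (Fin n) → ℝ}, Continuous f → ∀ x, Tendsto
      (fun q : ℕ × EuclideanSpace ℝ (Fin n) => f q.2) (atTop ×ˢ 𝓝 x) (𝓝 (f x)) :=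
    fun hf x => (hf.tendsto x).comp tendsto_snd
  have lim1 : ∀ x, Tendsto (fun q : ℕ × EuclideanSpace ℝ (Fin n) =>
      |mollify (φ q.1) w q.2 - w q.2|) (atTop ×ˢ 𝓝 x) (𝓝 0) := fun x => by
    simpa using ((t hw.continuous x).sub (s hw.continuous x)).abs
  have lim2 : ∀ x, Tendsto (fun q : ℕ × EuclideanSpace ℝ (Fin n) =>
      |logPotential (mollify (φ q.1) w) q.2 - logPotential w q.2|) (atTop ×ˢ 𝓝 x) (𝓝 0) :=
    fun x => by
      have h : Tendsto (fun q : ℕ × EuclideanSpace ℝ (Fin n) =>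
          logPotential (mollify (φ q.1) w) q.2) (atTop ×ˢ 𝓝 x) (𝓝 (logPotential w x)) := by
        simp only [logPotential_mollify _ hw]
        exact (((t hL.continuous x).add
          (tendsto_finsetSum _ fun i _ => (t (c i).continuous x).pow 2)).add
          ((t hw.continuous x).const_mul 2)).neg
      simpa using (h.sub (s hU.continuous x)).abs
  have lim3 : ∀ x, Tendsto (fun q : ℕ × EuclideanSpace ℝ (Fin n) =>
      ∑ j, (pd j (logPotential (mollify (φ q.1) w)) q.2 - pd j (logPotential w) q.2) ^ 2)
      (atTop ×ˢ 𝓝 x) (𝓝 0) := fun x => by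
    have h : ∀ j, Tendsto (fun q : ℕ × EuclideanSpace ℝ (Fin n) =>
        pd j (logPotential (mollify (φ q.1) w)) q.2) (atTop ×ˢ 𝓝 x)
        (𝓝 (pd j (logPotential w) x)) := fun j => by
      simp only [pd_logPotential_mollify _ hw hL]
      rw [pd_logPotential_eq hw hL]
      exact (((t (hL' j) x).add (tendsto_finsetSum _ fun i _ =>
        ((t (c i).continuous x).const_mul 2).mul (t (c' i j) x))).add
        ((t (c j).continuous x).const_mul 2)).neg
    simpa using tendsto_finsetSum Finset.univ fun j _ => ((h j).sub (s (cU j) x)).pow 2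
  have ev : ∀ᶠ k in atTop, ∀ y ∈ Metric.closedBall x₀ R,
      |mollify (φ k) w y - w y| < δ ∧
        |logPotential (mollify (φ k) w) y - logPotential w y| < δ ∧
        ∑ j, (pd j (logPotential (mollify (φ k) w)) y - pd j (logPotential w) y) ^ 2 < δ := by
    have hP : ∀ x ∈ Metric.closedBall x₀ R,
        ∀ᶠ q : ℕ × EuclideanSpace ℝ (Fin n) in atTop ×ˢ 𝓝 x,
          |mollify (φ q.1) w q.2 - w q.2| < δ ∧
          |logPotential (mollify (φ q.1) w) q.2 - logPotential w q.2| < δ ∧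
          ∑ j, (pd j (logPotential (mollify (φ q.1) w)) q.2 - pd j (logPotential w) q.2) ^ 2 < δ :=
      fun x _ => ((lim1 x).eventually_lt_const hδ).and
        (((lim2 x).eventually_lt_const hδ).and ((lim3 x).eventually_lt_const hδ))
    -- Compactness of the ball merges the pointwise product filters into `atTop ×ˢ 𝓝ˢ` of the ball,
    -- giving one index valid on the whole ball.
    simp only [← eventually_iSup, ← (isCompact_closedBall x₀ R).prod_nhdsSet_eq_biSup] at hP
    exact hP.curry.mono fun _ h => h.self_of_nhdsSet
  obtain ⟨k, hk⟩ := ev.exists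
  exact ⟨mollify (φ k) w, contDiff_mollify _ hw.continuous, hk⟩

end Mollification

/-! ### Removal of the extra regularity and application to positive solutions. -/

section Solutions

variable {n : ℕ}

theorem pd_add_const (f : EuclideanSpace ℝ (Fin n) → ℝ) (c : ℝ) (i : Fin n) :
    pd i (fun y => f y + c) = pd i f := by
  funext x; simp [pd]

theorem logPotential_add_const (w : EuclideanSpace ℝ (Fin n) → ℝ) (c : ℝ) :
    logPotential (fun y => w y + c) = fun y => logPotential w y + -2 * c := by
  funext y
  simp only [logPotential, gradSq, pd_add_const]
  ring

/-- Interior upper bound for a `C²` function `w`, without any further regularity. -/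
theorem le_of_logPotential_bounds_of_contDiff_two (hn : 1 ≤ n)
    {w W : EuclideanSpace ℝ (Fin n) → ℝ} (hw : ContDiff ℝ 2 w)
    (hU : ContDiff ℝ 1 (logPotential w)) (hW : ContDiff ℝ 2 W)
    {x₀ : EuclideanSpace ℝ (Fin n)} {R K D : ℝ} (hR : 0 < R) (hK : 0 ≤ K) (hW₀ : 0 ≤ W x₀)
    (hWU : ∀ y ∈ Metric.closedBall x₀ R, W y ≤ 2 * logPotential w y)
    (hΔ : ∀ y ∈ Metric.closedBall x₀ R, -K ≤ ∑ i, pd i (pd i W) y)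
    (hD : ∀ y ∈ Metric.closedBall x₀ R,
      ∑ i, (pd i W y - pd i (logPotential w) y) ^ 2 ≤ D) :
    w x₀ ≤ n + 20 * n ^ 2 * R⁻¹ ^ 2 + K / 8 + D / 16 := by
  have hx₀ := Metric.mem_closedBall_self (x := x₀) hR.le
  have hD0 : 0 ≤ D := (Finset.sum_nonneg fun _ _ => sq_nonneg _).trans (hD x₀ hx₀)
  refine le_of_forall_pos_le_add fun η hη => ?_
  -- The total error is at most 2δ + (εD + ε)/16 with δ ≤ ε, hence at most ε(D + 3) = η. The choice
  -- δ = ε²/(1 + ε) makes the Young factor 1 + 1/ε cost exactly ε.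
  set ε := η / (D + 3) with hε
  have hε0 : 0 < ε := by positivity
  have hεη : ε * (D + 3) = η := div_mul_cancel₀ _ (by positivity)
  have hδ : 0 < ε ^ 2 / (1 + ε) := by positivity
  have hδε : ε ^ 2 / (1 + ε) ≤ ε := by
    rw [div_le_iff₀ (by positivity)]; nlinarith
  have hδ1 : (1 + 1 / ε) * (ε ^ 2 / (1 + ε)) = ε := by field_simp; ring
  obtain ⟨v, hv, hvw⟩ := exists_contDiff_approx hw hU x₀ R hδ
  set δ := ε ^ 2 / (1 + ε)
  -- Lowering v by δ raises its potential by 2δ, more than the approximation error δ, so W ≤ 2U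
  -- survives.
  have key := le_of_logPotential_bounds hn (w := fun y => v y + -δ) (W := W)
    (hv.add contDiff_const) hW hR hK hW₀ (D := (1 + ε) * D + ε) ?_ hΔ ?_
  · have := (abs_lt.mp (hvw x₀ hx₀).1).1
    nlinarith
  · intro y hy
    have := (abs_lt.mp (hvw y hy).2.1).1
    rw [logPotential_add_const]
    linarith [hWU y hy]
  · intro y hy
    rw [logPotential_add_const]
    simp only [pd_add_const]
    calc ∑ i, (pd i W y - pd i (logPotential v) y) ^ 2
        ≤ ∑ i, ((1 + ε) * (pd i W y - pd i (logPotential w) y) ^ 2 +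
          (1 + 1 / ε) * (pd i (logPotential v) y - pd i (logPotential w) y) ^ 2) := by
          refine Finset.sum_le_sum fun i _ => ?_
          have h0 : 0 ≤ (ε * (pd i W y - pd i (logPotential w) y) +
            (pd i (logPotential v) y - pd i (logPotential w) y)) ^ 2 / ε := by positivity
          have e : (ε * (pd i W y - pd i (logPotential w) y) +
              (pd i (logPotential v) y - pd i (logPotential w) y)) ^ 2 / ε =
              (1 + ε) * (pd i W y - pd i (logPotential w) y) ^ 2 +
              (1 + 1 / ε) * (pd i (logPotential v) y - pd i (logPotential w) y) ^ 2 -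
              (pd i W y - pd i (logPotential v) y) ^ 2 := by field_simp; ring
          linarith
      _ ≤ (1 + ε) * D + (1 + 1 / ε) * δ := by
          rw [Finset.sum_add_distrib, ← Finset.mul_sum, ← Finset.mul_sum]
          have := hD y hy
          have := (hvw y hy).2.2.le
          gcongr
      _ = (1 + ε) * D + ε := by rw [hδ1]

theorem IsPositiveSolution.contDiff_log {V u : EuclideanSpace ℝ (Fin n) → ℝ}
    (h : IsPositiveSolution V u) : ContDiff ℝ 2 fun y => Real.log (u y) :=
  h.contDiff.log fun y => (h.pos y).ne'

/-- With w = log u one has Δu = u(Δw + |∇w|²), so the equation can be divided by u. -/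
theorem IsPositiveSolution.logPotential_log {V u : EuclideanSpace ℝ (Fin n) → ℝ}
    (h : IsPositiveSolution V u) : logPotential (fun y => Real.log (u y)) = V := by
  have du : Differentiable ℝ u := h.contDiff.differentiable (by norm_num)
  have du' : ∀ i, Differentiable ℝ (pd i u) := fun i =>
    (h.contDiff.pd (m := 2) (k := 1) (by norm_num) i).differentiable (by norm_num)
  have dw' : ∀ i, Differentiable ℝ (pd i fun y => Real.log (u y)) := fun i =>
    (h.contDiff_log.pd (m := 2) (k := 1) (by norm_num) i).differentiable (by norm_num)
  have hne : ∀ y, u y ≠ 0 := fun y => (h.pos y).ne'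
  funext x
  have e1 : ∀ i, pd i u = fun y => u y * pd i (fun y => Real.log (u y)) y := fun i => by
    funext y
    rw [pd_log (du y) (hne y), mul_div_cancel₀ _ (hne y)]
  have e2 : ∀ i, pd i (pd i u) x =
      u x * (pd i (pd i fun y => Real.log (u y)) x + pd i (fun y => Real.log (u y)) x ^ 2) :=
    fun i => by
      conv_lhs => rw [e1 i]
      rw [pd_mul (du x) (dw' i x)]
      conv_lhs => rw [e1 i]
      ring
  have heq := h.equation x
  rw [laplacian_eq_sum_pd h.contDiff] at heq
  simp only [e2] at heq
  rw [← Finset.mul_sum, Finset.sum_add_distrib] at heq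
  have : u x * (∑ i, pd i (pd i fun y => Real.log (u y)) x + gradSq (fun y => Real.log (u y)) x
      + 2 * Real.log (u x) + V x) = 0 := by
    rw [← heq, gradSq]; ring
  have := (mul_eq_zero.mp this).resolve_left (hne x)
  rw [logPotential]
  linarith

/-- The interior bound for the logarithm of a positive solution, after subtracting a constant
`c` from the potential. -/
theorem IsPositiveSolution.log_le (hn : 1 ≤ n) {V u W : EuclideanSpace ℝ (Fin n) → ℝ}
    (h : IsPositiveSolution V u) (hV : ContDiff ℝ 2 V) (hW : ContDiff ℝ 2 W) (c : ℝ)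
    {x₀ : EuclideanSpace ℝ (Fin n)} {R K D : ℝ} (hR : 0 < R) (hK : 0 ≤ K) (hW₀ : 0 ≤ W x₀)
    (hWV : ∀ y ∈ Metric.closedBall x₀ R, W y ≤ 2 * (V y - c))
    (hΔ : ∀ y ∈ Metric.closedBall x₀ R, -K ≤ ∑ i, pd i (pd i W) y)
    (hD : ∀ y ∈ Metric.closedBall x₀ R, ∑ i, (pd i W y - pd i V y) ^ 2 ≤ D) :
    Real.log (u x₀) ≤ n + 20 * n ^ 2 * R⁻¹ ^ 2 + K / 8 + D / 16 - c / 2 := by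
  have hpot : logPotential (fun y => Real.log (u y) + c / 2) = fun y => V y + -2 * (c / 2) := by
    rw [logPotential_add_const, h.logPotential_log]
  have key := le_of_logPotential_bounds_of_contDiff_two hn (W := W)
    (w := fun y => Real.log (u y) + c / 2) (h.contDiff_log.add contDiff_const)
    (by rw [hpot]; exact (hV.of_le (by norm_num)).add contDiff_const) hW hR hK hW₀
    (fun y hy => by rw [hpot]; linarith [hWV y hy]) hΔ
    (fun y hy => by simpa only [hpot, pd_add_const] using hD y hy)
  linarith

theorem norm_fderiv_eq_norm_gradient (V : EuclideanSpace ℝ (Fin n) → ℝ)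
    (x : EuclideanSpace ℝ (Fin n)) : ‖fderiv ℝ V x‖ = ‖gradient V x‖ :=
  ((InnerProductSpace.toDual ℝ _).symm.norm_map _).symm

theorem IsPositiveSolution.le_exp_gradientExponent (hn : 1 ≤ n)
    {V u : EuclideanSpace ℝ (Fin n) → ℝ} (h : IsPositiveSolution V u) (hV : ContDiff ℝ 2 V)
    (hb : IsBoundedFun V) (hg : IsBoundedFun fun x => ‖gradient V x‖)
    (x : EuclideanSpace ℝ (Fin n)) : u x ≤ Real.exp (gradientExponent V x) := by
  have hn' : (1 : ℝ) ≤ n := by exact_mod_cast hn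
  obtain ⟨C, hC⟩ := hb
  obtain ⟨G, hG⟩ := hg
  have hM : ∀ y, |V y| ≤ ⨆ y, |V y| := le_ciSup ⟨C, by rintro _ ⟨y, rfl⟩; exact hC y⟩
  have hS : ∀ y, ‖gradient V y‖ ^ 2 ≤ ⨆ y, ‖gradient V y‖ ^ 2 := le_ciSup ⟨G ^ 2, by
    rintro _ ⟨y, rfl⟩
    have := hG y
    rw [abs_norm] at this
    exact pow_le_pow_left₀ (norm_nonneg _) this 2⟩
  rw [← Real.log_le_iff_le_exp (h.pos x), gradientExponent]
  set M := ⨆ y, |V y|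
  set S := ⨆ y, ‖gradient V y‖ ^ 2
  have hS0 : 0 ≤ S := (sq_nonneg _).trans (hS x)
  set R := 4 * √(n : ℝ) with hRdef
  have hsq : √(n : ℝ) ^ 2 = n := Real.sq_sqrt (by linarith)
  have hR : 0 < R := by have := Real.sqrt_pos.mpr (show (0 : ℝ) < n by linarith); positivity
  have hR2 : R⁻¹ ^ 2 = 1 / (16 * n) := by
    rw [inv_pow, hRdef, mul_pow, hsq]; norm_num
  -- By the mean value inequality V ≥ V(x) − R√S on the ball, so this c makes V − c nonnegative
  -- there and W = 0 admissible.
  have key := h.log_le hn hV (W := fun _ => 0) (x₀ := x) (R := R) (K := 0) (D := S)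
    contDiff_const (V x - R * √S) hR le_rfl le_rfl ?_ ?_ ?_
  · have e : 20 * (n : ℝ) ^ 2 * R⁻¹ ^ 2 = 5 / 4 * n := by rw [hR2]; field_simp; norm_num
    rw [e] at key
    -- Since R = 4√n, the left side is 2√n√S. The resulting coefficients 43/12 of n and 13/16 of S
    -- lie below 16/3 and 8/9.
    have hamgm : R * √S / 2 ≤ 3 / 4 * S + 4 / 3 * n := by
      have h1 := Real.sq_sqrt hS0
      rw [hRdef]
      nlinarith [sq_nonneg (3 * √S - 4 * √(n : ℝ))]
    have h1 := hM x
    have h2 := le_abs_self (V x)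
    have h3 := abs_nonneg (V x)
    linarith
  · intro y hy
    have hlip := (convex_univ (𝕜 := ℝ)).norm_image_sub_le_of_norm_fderiv_le (f := V) (C := √S)
      (x := x) (y := y) (fun z _ => hV.differentiable (by norm_num) z)
      (fun z _ => by
        rw [norm_fderiv_eq_norm_gradient]; exact Real.le_sqrt_of_sq_le (hS z))
      (Set.mem_univ _) (Set.mem_univ _)
    rw [mem_closedBall_iff_norm] at hy
    have h1 : √S * ‖y - x‖ ≤ R * √S := by
      rw [mul_comm]; gcongr
    have h2 := (abs_le.mp (hlip.trans h1)).1
    linarith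
  · intro y _
    have e : ∀ i : Fin n, pd i (pd i fun _ : EuclideanSpace ℝ (Fin n) => (0 : ℝ)) y = 0 := fun i => by
      rw [show (pd i fun _ : EuclideanSpace ℝ (Fin n) => (0 : ℝ)) = fun _ => 0 from
        funext fun z => pd_const 0 i]
      exact pd_const 0 i
    simp [e]
  · intro y _
    have := hS y
    rw [norm_gradient_sq] at this
    simpa [pd_const] using this

theorem IsPositiveSolution.le_exp_laplacianExponent (hn : 1 ≤ n)
    {V u : EuclideanSpace ℝ (Fin n) → ℝ} (h : IsPositiveSolution V u) (hV : ContDiff ℝ 2 V)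
    (hb : IsBoundedFun V) (hl : IsBoundedFun (Laplacian.laplacian V))
    (x : EuclideanSpace ℝ (Fin n)) : u x ≤ Real.exp (laplacianExponent V) := by
  have hn' : (1 : ℝ) ≤ n := by exact_mod_cast hn
  obtain ⟨C, hC⟩ := hb
  obtain ⟨G, hG⟩ := hl
  have hM : ∀ y, |V y| ≤ ⨆ y, |V y| := le_ciSup ⟨C, by rintro _ ⟨y, rfl⟩; exact hC y⟩
  have hK : ∀ y, |Laplacian.laplacian V y| ≤ ⨆ y, |Laplacian.laplacian V y| :=
    le_ciSup ⟨G, by rintro _ ⟨y, rfl⟩; exact hG y⟩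
  have hD : 0 ≤ ⨆ y, ‖gradient V y‖ := Real.iSup_nonneg fun _ => norm_nonneg _
  rw [← Real.log_le_iff_le_exp (h.pos x), laplacianExponent]
  set M := ⨆ y, |V y|
  set K := ⨆ y, |Laplacian.laplacian V y|
  have hK0 : 0 ≤ K := (abs_nonneg _).trans (hK x)
  have hM0 : 0 ≤ M := (abs_nonneg _).trans (hM x)
  set R := √(40 * n : ℝ) with hRdef
  have hR : 0 < R := Real.sqrt_pos.mpr (by linarith)
  have hR2 : R⁻¹ ^ 2 = 1 / (40 * n) := by
    rw [inv_pow, hRdef, Real.sq_sqrt (by linarith), one_div]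
  have hVM : ∀ y, 0 ≤ V y + M := fun y => by linarith [hM y, neg_abs_le (V y)]
  -- V + M ≥ 0 gives both W ≥ 0 and W ≤ 2(V + M). With R² = 40n the cutoff error is n/2, so log u ≤
  -- 3n/2 + K/8 + M/2.
  have key := h.log_le hn hV (W := fun y => V y + M) (x₀ := x) (R := R) (K := K) (D := 0)
    (hV.add contDiff_const) (-M) hR hK0 (hVM x) (fun y _ => by linarith [hVM y])
    (fun y _ => ?_) (fun y _ => by simp [pd_add_const])
  · have e : 20 * (n : ℝ) ^ 2 * R⁻¹ ^ 2 = n / 2 := by rw [hR2]; field_simp; norm_num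
    rw [e] at key
    linarith
  · simp only [pd_add_const]
    rw [← laplacian_eq_sum_pd hV]
    linarith [hK y, neg_abs_le (Laplacian.laplacian V y)]

theorem gradientExponent_const (c : ℝ) (x : EuclideanSpace ℝ (Fin n)) :
    gradientExponent (fun _ => c) x = (1 / 3 : ℝ) * (16 * n + 8 * |c| - 8 * c) := by
  simp [gradientExponent, gradient_fun_const]

theorem laplacianExponent_const (c : ℝ) :
    laplacianExponent (fun _ : EuclideanSpace ℝ (Fin n) => c) = 2 * n + 2 * |c| := by
  have : Laplacian.laplacian (fun _ : EuclideanSpace ℝ (Fin n) => c) = fun _ => 0 :=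
    InnerProductSpace.laplacian_const
  simp [laplacianExponent, gradient_fun_const, this]

end Solutions

theorem theorem1p3 (n : ℕ) (hn : 1 ≤ n) :
    -- the two estimates, for a `C²` potential `V` and a positive solution `u`
    (∀ V u : EuclideanSpace ℝ (Fin n) → ℝ, ContDiff ℝ 2 V → IsPositiveSolution V u →
      (IsBoundedFun V → IsBoundedFun (fun x => ‖gradient V x‖) →
        IsBoundedFun u ∧ ∀ x, u x ≤ Real.exp (gradientExponent V x)) ∧
      (IsBoundedFun V → IsBoundedFun (Laplacian.laplacian V) →
        IsBoundedFun (fun x => ‖gradient V x‖) →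
        IsBoundedFun u ∧ ∀ x, u x ≤ Real.exp (laplacianExponent V))) ∧
    -- for a constant potential `c ≥ 0` the first bound does not involve `c`
    (∀ c : ℝ, 0 ≤ c → ∀ x : EuclideanSpace ℝ (Fin n),
      gradientExponent (fun _ => c) x = 16 * (n : ℝ) / 3) ∧
    -- for a constant potential `c ≤ 0` the second bound is the sharper one
    (∀ c : ℝ, c ≤ 0 → ∀ x : EuclideanSpace ℝ (Fin n),
      laplacianExponent (fun _ : EuclideanSpace ℝ (Fin n) => c) <
        gradientExponent (fun _ => c) x) := by
  refine ⟨fun V u hV h => ⟨fun hb hg => ?_, fun hb hl _ => ?_⟩, fun c hc x => ?_, fun c hc x => ?_⟩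
  · have hle := h.le_exp_gradientExponent hn hV hb hg
    refine ⟨?_, hle⟩
    obtain ⟨C, hC⟩ := hb
    refine ⟨Real.exp ((1 / 3 : ℝ) * (16 * (n : ℝ) + 8 * (⨆ y, |V y|)
      + (8 / 3 : ℝ) * (⨆ y, ‖gradient V y‖ ^ 2) + 8 * C)), fun x => ?_⟩
    rw [abs_of_pos (h.pos x)]
    refine (hle x).trans (Real.exp_le_exp.mpr ?_)
    rw [gradientExponent]
    linarith [(abs_le.mp (hC x)).1]
  · have hle := h.le_exp_laplacianExponent hn hV hb hl
    exact ⟨⟨_, fun x => (abs_of_pos (h.pos x)).trans_le (hle x)⟩, hle⟩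
  · rw [gradientExponent_const, abs_of_nonneg hc]; ring
  · have hn' : (1 : ℝ) ≤ n := by exact_mod_cast hn
    rw [gradientExponent_const, laplacianExponent_const, abs_of_nonpos hc]
    linarith
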